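/- Let $d\ge 1$ be an integer and $\sigma>0$. Let $B_2^d\subseteq\mathbb R^d$ be the closed Euclidean unit ball, let $H_\sigma(B_2^d)$ be the real reproducing kernel Hilbert space of the Gaussian kernel $k_\sigma(x,x')=\exp(-\sigma^2\|x-x'\|_2^2)$ on $B_2^d$, and let $\mathrm{Id}:H_\sigma(B_2^d)\to\ell_\infty(B_2^d)$ be the canonical embedding into the space of bounded functions on $B_2^d$ with the supremum norm. For a bounded linear operator $T:E\to F$ between Banach spaces and $\varepsilon>0$, the log-covering number $\mathcal H(\varepsilon,T)$ is $\log n$, where $n$ is the least number of closed balls of radius $\varepsilon$ with centres in $F$ that cover the image under $T$ of the closed unit ball of $E$. Let $W_0:[-1/e,\infty)\to[-1,\infty)$ be the upper branch of Lambert's $W$-function, i.e. the inverse of $t\mapsto te^t$ on $[-1,\infty)$, and let $\binom{t}{k}=\frac1{k!}\prod_{i=1}^k(t-k+i)$ for real $t$ and integers $k\ge 1$. For $\varepsilon_0>0$ set $$y_0=\log\frac{4}{\varepsilon_0},\qquad x_0=\frac{2y_0}{W_0\bigl(\frac{y_0}{e\sigma^2}\bigr)},\qquad K_{d,\sigma,\varepsilon_0}=\binom{x_0+d}{d}\Bigl(\frac{\log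 y_0}{y_0}\Bigr)^d$$ whenever these expressions are defined, in particular for $0<\varepsilon_0\le 4\exp(-e^{1+\sigma^{-2}})$. If $0<\varepsilon_0\le 4\exp(-e^{1+\sigma^{-2}})$, then for all $0<\varepsilon\le\varepsilon_0$ $$\mathcal H\bigl(\varepsilon,\ \mathrm{Id}:H_\sigma(B_2^d)\to\ell_\infty(B_2^d)\bigr)\le K_{d,\sigma,\varepsilon_0}\cdot\frac{\bigl(\log(4/\varepsilon)\bigr)^{d+1}}{\bigl(\log\log(4/\varepsilon)\bigr)^d}.$$ Moreover, $\lim_{\varepsilon_0\to0^+}K_{d,\sigma,\varepsilon_0}=\dfrac{2^d}{d!}$ for all $d\ge1$ and $\sigma>0$. -/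

import Mathlib

open Set Filter Topology
open scoped ENNReal NNReal ComplexOrder InnerProductSpace

noncomputable section

/-- The Gaussian kernel `k_σ(x, y) = exp (-σ² ‖x - y‖₂²)` of width `σ` on `X ⊆ ℝᵈ`, as a kernel
with values in the (one-dimensional) algebra of operators on `ℝ`; that is, the scalar
`k_σ(x, y)` acts on `ℝ` by multiplication. -/
def gaussianKernel {d : ℕ} (σ : ℝ) (X : Set (EuclideanSpace ℝ (Fin d))) :
    Matrix X X (ℝ →L[ℝ] ℝ) :=
  Matrix.of fun x y =>
    Real.exp (-σ ^ 2 * ‖(x : EuclideanSpace ℝ (Fin d)) - y‖ ^ 2) • ContinuousLinearMap.id ℝ ℝ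

lemma gaussianKernel_apply {d : ℕ} (σ : ℝ) (X : Set (EuclideanSpace ℝ (Fin d))) (x y : X) (c : ℝ) :
    gaussianKernel σ X x y c =
      Real.exp (-σ ^ 2 * ‖(x : EuclideanSpace ℝ (Fin d)) - y‖ ^ 2) * c := by
  simp [gaussianKernel]

/-- The scalar Gaussian kernel is positive semidefinite. -/
lemma gaussian_sum_nonneg {d : ℕ} (σ : ℝ) {ι : Type*} (s : Finset ι)
    (p : ι → EuclideanSpace ℝ (Fin d)) (c : ι → ℝ) :
    0 ≤ ∑ i ∈ s, ∑ j ∈ s, Real.exp (-σ ^ 2 * ‖p j - p i‖ ^ 2) * c i * c j := by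
  by_cases hσ : σ = 0
  · subst hσ
    have : ∑ i ∈ s, ∑ j ∈ s, Real.exp (-0 ^ 2 * ‖p j - p i‖ ^ 2) * c i * c j
        = (∑ i ∈ s, c i) * (∑ i ∈ s, c i) := by
      simp [Finset.sum_mul_sum]
    rw [this]
    exact mul_self_nonneg _
  have h4 : 0 < 4 * σ ^ 2 := by positivity
  set g : EuclideanSpace ℝ (Fin d) → ℝ := fun z => Real.exp (-(4 * σ ^ 2) * ‖z‖ ^ 2) with hg
  have hval : ∫ z, g z = (Real.pi / (4 * σ ^ 2)) ^
      (Module.finrank ℝ (EuclideanSpace ℝ (Fin d)) / 2 : ℝ) :=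
    GaussianFourier.integral_rexp_neg_mul_sq_norm h4
  have hpos : 0 < ∫ z, g z := by
    rw [hval]
    have := Real.pi_pos
    positivity
  have hint : MeasureTheory.Integrable g := by
    by_contra h
    rw [MeasureTheory.integral_undef h] at hpos
    exact lt_irrefl _ hpos
  have key : ∀ x y z : EuclideanSpace ℝ (Fin d),
      Real.exp (-(2 * σ ^ 2) * ‖z - x‖ ^ 2) * Real.exp (-(2 * σ ^ 2) * ‖z - y‖ ^ 2)
        = Real.exp (-σ ^ 2 * ‖y - x‖ ^ 2) * g (z - (1 / 2 : ℝ) • (x + y)) := by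
    intro x y z
    simp only [hg]
    rw [← Real.exp_add, ← Real.exp_add]
    congr 1
    have hp := parallelogram_law_with_norm ℝ (z - x) (z - y)
    have e1 : z - x + (z - y) = (2 : ℝ) • (z - (1 / 2 : ℝ) • (x + y)) := by
      module
    have e2 : z - x - (z - y) = y - x := by abel
    rw [e1, e2, norm_smul, Real.norm_ofNat] at hp
    nlinarith [hp]
  have hk : ∀ x y : EuclideanSpace ℝ (Fin d),
      ∫ z, Real.exp (-(2 * σ ^ 2) * ‖z - x‖ ^ 2) * Real.exp (-(2 * σ ^ 2) * ‖z - y‖ ^ 2)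
        = Real.exp (-σ ^ 2 * ‖y - x‖ ^ 2) * ∫ z, g z := by
    intro x y
    simp_rw [key x y]
    rw [MeasureTheory.integral_const_mul, MeasureTheory.integral_sub_right_eq_self g]
  have hki : ∀ x y : EuclideanSpace ℝ (Fin d), MeasureTheory.Integrable fun z =>
      Real.exp (-(2 * σ ^ 2) * ‖z - x‖ ^ 2) * Real.exp (-(2 * σ ^ 2) * ‖z - y‖ ^ 2) := by
    intro x y
    simp_rw [key x y]
    exact (hint.comp_sub_right _).const_mul _
  refine nonneg_of_mul_nonneg_left (b := ∫ z, g z) ?_ hpos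
  have hsum : (∑ i ∈ s, ∑ j ∈ s, Real.exp (-σ ^ 2 * ‖p j - p i‖ ^ 2) * c i * c j) * (∫ z, g z)
      = ∫ z, (∑ i ∈ s, c i * Real.exp (-(2 * σ ^ 2) * ‖z - p i‖ ^ 2)) *
          (∑ i ∈ s, c i * Real.exp (-(2 * σ ^ 2) * ‖z - p i‖ ^ 2)) := by
    have hre : ∀ z, (∑ i ∈ s, c i * Real.exp (-(2 * σ ^ 2) * ‖z - p i‖ ^ 2)) *
          (∑ i ∈ s, c i * Real.exp (-(2 * σ ^ 2) * ‖z - p i‖ ^ 2))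
        = ∑ i ∈ s, ∑ j ∈ s, (c i * c j) * (Real.exp (-(2 * σ ^ 2) * ‖z - p i‖ ^ 2) *
            Real.exp (-(2 * σ ^ 2) * ‖z - p j‖ ^ 2)) := by
      intro z
      rw [Finset.sum_mul_sum]
      exact Finset.sum_congr rfl fun i _ => Finset.sum_congr rfl fun j _ => by ring
    simp_rw [hre]
    rw [MeasureTheory.integral_finsetSum _ fun i _ =>
      MeasureTheory.integrable_finsetSum _ fun j _ => (hki _ _).const_mul _]
    rw [Finset.sum_mul]
    refine Finset.sum_congr rfl fun i _ => ?_
    rw [MeasureTheory.integral_finsetSum _ fun j _ => (hki _ _).const_mul _, Finset.sum_mul]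
    refine Finset.sum_congr rfl fun j _ => ?_
    rw [MeasureTheory.integral_const_mul, hk]
    ring
  rw [hsum]
  exact MeasureTheory.integral_nonneg fun z => mul_self_nonneg _

lemma gaussianKernel_posSemidef {d : ℕ} (σ : ℝ) (X : Set (EuclideanSpace ℝ (Fin d))) :
    (gaussianKernel σ X).PosSemidef := by
  have h02 := (RKHS.posSemidef_tfae (K := gaussianKernel σ X)).out 0 2
  refine h02.2 ⟨?_, fun v => ?_⟩
  · ext x y
    have h1 : star (ContinuousLinearMap.id ℝ ℝ) = ContinuousLinearMap.id ℝ ℝ :=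
      star_one (ℝ →L[ℝ] ℝ)
    simp [gaussianKernel, Matrix.conjTranspose_apply, norm_sub_rev, h1]
  · have h := gaussian_sum_nonneg σ v.support (fun x : X => (x : EuclideanSpace ℝ (Fin d))) v
    simp only [Finsupp.sum, gaussianKernel_apply, RCLike.re_to_real]
    refine h.trans_eq (Finset.sum_congr rfl fun i _ => Finset.sum_congr rfl fun j _ => ?_)
    simp only [RCLike.inner_apply, conj_trivial]
    ring

instance gaussianKernel_fact {d : ℕ} (σ : ℝ) (X : Set (EuclideanSpace ℝ (Fin d))) :
    Fact (gaussianKernel σ X).PosSemidef :=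
  ⟨gaussianKernel_posSemidef σ X⟩

/-- `H_σ(X)`: the reproducing kernel Hilbert space of the Gaussian kernel `k_σ` on `X ⊆ ℝᵈ`. -/
abbrev GaussianRKHS {d : ℕ} (σ : ℝ) (X : Set (EuclideanSpace ℝ (Fin d))) : Type :=
  RKHS.OfKernel (gaussianKernel σ X)

lemma gaussianRKHS_abs_apply_le {d : ℕ} (σ : ℝ) (X : Set (EuclideanSpace ℝ (Fin d)))
    (f : GaussianRKHS σ X) (x : X) : ‖f x‖ ≤ ‖f‖ := by
  have h := RKHS.norm_apply_le f x
  rw [RKHS.OfKernel.kernel_ofKernel] at h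
  simpa [gaussianKernel] using h

/-- The canonical embedding `Id : H_σ(X) → ℓ_∞(X)`, `f ↦ (f(x))_{x ∈ X}`, into the Banach space
of bounded functions `X → ℝ` with the supremum norm. -/
def gaussianEmbedding {d : ℕ} (σ : ℝ) (X : Set (EuclideanSpace ℝ (Fin d))) :
    GaussianRKHS σ X →L[ℝ] lp (fun _ : X => ℝ) ∞ :=
  LinearMap.mkContinuous
    { toFun := fun f => ⟨fun x => f x, memℓp_infty ⟨‖f‖, by
        rintro _ ⟨x, rfl⟩
        exact gaussianRKHS_abs_apply_le σ X f x⟩⟩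
      map_add' := fun f g => by ext x; exact congrFun (RKHS.coe_add f g) x
      map_smul' := fun c f => by ext x; exact congrFun (RKHS.coe_smul f c) x }
    1 (fun f => by
      rw [one_mul]
      exact lp.norm_le_of_forall_le (norm_nonneg f) fun x => gaussianRKHS_abs_apply_le σ X f x)

/-- The log-covering number of a bounded operator `T : E → F` at radius `ε > 0`: the logarithm of
the least number of closed `ε`-balls of `F`, with arbitrary centres in `F`, that cover the image
under `T` of the closed unit ball of `E`. It is an extended real number, `⊤` when no finite
number of balls suffices. -/
def logCoveringNumber {E F : Type*} [NormedAddCommGroup E] [NormedSpace ℝ E]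
    [NormedAddCommGroup F] [NormedSpace ℝ F] (ε : ℝ) (T : E →L[ℝ] F) : EReal :=
  ENNReal.log
    (Metric.externalCoveringNumber ε.toNNReal (T '' Metric.closedBall (0 : E) 1) : ℝ≥0∞)

/-- The upper branch `W₀ : [-1/e, ∞) → [-1, ∞)` of Lambert's `W`-function: the inverse of
`t ↦ t eᵗ` on `[-1, ∞)`. -/
def lambertW0 : ℝ → ℝ :=
  Function.invFunOn (fun t : ℝ => t * Real.exp t) (Ici (-1))

/-- The generalized binomial coefficient `binom(t, k) = (1 / k!) ∏_{i=1}^k (t - k + i)`. -/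
def genBinom (t : ℝ) (k : ℕ) : ℝ :=
  1 / (k.factorial : ℝ) * ∏ i ∈ Finset.Icc 1 k, (t - k + i)

/-- `y₀ = log (4 / ε₀)`. -/
def yZero (ε₀ : ℝ) : ℝ := Real.log (4 / ε₀)

/-- `x₀ = 2 y₀ / W₀(y₀ / (e σ²))`. -/
def xZero (σ ε₀ : ℝ) : ℝ :=
  2 * yZero ε₀ / lambertW0 (yZero ε₀ / (Real.exp 1 * σ ^ 2))

/-- The constant `K_{d, σ, ε₀} = binom(x₀ + d, d) (log y₀ / y₀)ᵈ`. -/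
def entropyConst (d : ℕ) (σ ε₀ : ℝ) : ℝ :=
  genBinom (xZero σ ε₀ + d) d * (Real.log (yZero ε₀) / yZero ε₀) ^ d

end

/-! The kernel factors as `exp(-σ²‖x‖²) exp(-σ²‖y‖²) exp(2σ²⟪x, y⟫)`. Expanding the last exponential
gives `k(x, y) = ∑ e_w(x) e_w(y)` over words `w` in the `d` coordinates (`hasSum_gaussianMonomial`),
where `e_w` depends only on the multiset of letters. For `f` in the unit ball, keeping the words of
length `< N` costs at most `√((2σ²)^N / N!)` uniformly on the ball, and the truncation still has sup
norm at most `1` (`exists_approx_gaussianEmbedding`). With `N = M + 1` the truncations span a space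
of dimension at most `binom(M + d, d)`, and a volume argument covers its unit ball
(`externalCoveringNumber_le_of_approx_sum`). Lambert's function enters because `N ≥ x₀(ε)` makes the
truncation error at most `ε/4` (`pow_div_factorial_le`). Hence the log-covering number is at most
`binom(x₀(ε) + d, d) log(4/ε)`, which is the claim with `K` taken at `ε` itself. Passing to `ε₀`
needs `K` to be monotone (`entropyConst_mono`). Both this and the limit follow by writing `K` as a
product of factors `2 log y / W + i log y / y`. -/

/-! ### Lambert's function on the positive half-line. -/

lemma strictMonoOn_mul_exp : StrictMonoOn (fun t : ℝ => t * Real.exp t) (Ici 0) := by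
  intro a ha b hb hab
  have ha : 0 ≤ a := ha
  exact mul_lt_mul'' hab (Real.exp_lt_exp.2 hab) ha (Real.exp_pos a).le

lemma exists_mul_exp_eq {z : ℝ} (hz : 0 < z) : ∃ t : ℝ, t ∈ Ici (-1) ∧ t * Real.exp t = z := by
  have hc : ContinuousOn (fun t : ℝ => t * Real.exp t) (Icc 0 z) := by fun_prop
  have h := intermediate_value_Icc hz.le hc
  obtain ⟨t, ht, hteq⟩ := h (show z ∈ Icc _ _ from
    ⟨by simpa using hz.le, by
      have : 1 ≤ Real.exp z := Real.one_le_exp hz.le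
      simpa using le_mul_of_one_le_right hz.le this⟩)
  exact ⟨t, by have := ht.1; simp only [mem_Ici]; linarith, hteq⟩

lemma lambertW0_mul_exp {z : ℝ} (hz : 0 < z) : lambertW0 z * Real.exp (lambertW0 z) = z :=
  Function.invFunOn_eq (f := fun t : ℝ => t * Real.exp t) (exists_mul_exp_eq hz)

lemma lambertW0_pos {z : ℝ} (hz : 0 < z) : 0 < lambertW0 z :=
  pos_of_mul_pos_left ((lambertW0_mul_exp hz).symm ▸ hz) (Real.exp_pos _).le

lemma le_lambertW0 {t z : ℝ} (ht : 0 ≤ t) (hz : 0 < z) (h : t * Real.exp t ≤ z) :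
    t ≤ lambertW0 z := by
  rw [← lambertW0_mul_exp hz] at h
  exact (strictMonoOn_mul_exp.le_iff_le ht (lambertW0_pos hz).le).1 h

lemma lambertW0_le_lambertW0 {z w : ℝ} (hz : 0 < z) (h : z ≤ w) : lambertW0 z ≤ lambertW0 w :=
  le_lambertW0 (lambertW0_pos hz).le (hz.trans_le h) ((lambertW0_mul_exp hz).trans_le h)

lemma tendsto_lambertW0_atTop : Tendsto lambertW0 atTop atTop := by
  refine tendsto_atTop.2 fun b => ?_
  filter_upwards [eventually_gt_atTop 0, eventually_ge_atTop (max b 0 * Real.exp (max b 0))]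
    with z hz h
  exact (le_max_left _ _).trans (le_lambertW0 (le_max_right _ _) hz h)

/-! ### Comparison of `log y` with `W₀(y / (e σ²))`. -/

section Asymptotics

variable {σ y : ℝ}

lemma eq_lambertW0_mul_exp (hσ : 0 < σ) (hy : 0 < y) :
    y = Real.exp 1 * σ ^ 2 * (lambertW0 (y / (Real.exp 1 * σ ^ 2)) *
      Real.exp (lambertW0 (y / (Real.exp 1 * σ ^ 2)))) := by
  have : 0 < Real.exp 1 * σ ^ 2 := by positivity
  rw [lambertW0_mul_exp (by positivity)]
  field_simp

lemma log_eq_lambertW0 (hσ : 0 < σ) (hy : 0 < y) :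
    Real.log y = Real.log (Real.exp 1 * (σ ^ 2 * lambertW0 (y / (Real.exp 1 * σ ^ 2)))) +
      lambertW0 (y / (Real.exp 1 * σ ^ 2)) := by
  have hW : 0 < lambertW0 (y / (Real.exp 1 * σ ^ 2)) := lambertW0_pos (by positivity)
  conv_lhs => rw [eq_lambertW0_mul_exp hσ hy]
  rw [← mul_assoc, mul_assoc (Real.exp 1), Real.log_mul (by positivity) (by positivity),
    Real.log_exp]

/-- Taking logarithms in `y = e σ² W exp W` and dividing by `W` leaves only the function `log u / u`
at `u = e σ² W`, whose monotonicity and limit are known. -/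
lemma log_div_lambertW0 (hσ : 0 < σ) (hy : 0 < y) :
    Real.log y / lambertW0 (y / (Real.exp 1 * σ ^ 2)) =
      1 + Real.exp 1 * σ ^ 2 *
        (Real.log (Real.exp 1 * (σ ^ 2 * lambertW0 (y / (Real.exp 1 * σ ^ 2)))) /
          (Real.exp 1 * (σ ^ 2 * lambertW0 (y / (Real.exp 1 * σ ^ 2))))) := by
  have hW : 0 < lambertW0 (y / (Real.exp 1 * σ ^ 2)) := lambertW0_pos (by positivity)
  rw [log_eq_lambertW0 hσ hy]
  field_simp
  ring

/-- This is the source of the threshold on `ε₀`: the hypothesis says that `t = σ⁻²` satisfies `t exp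
t ≤ y / (e σ²)`. The conclusion puts `u = e σ² W` in `[e, ∞)`, where `log u / u` decreases. -/
lemma one_le_sq_mul_lambertW0 (hσ : 0 < σ) (hy : Real.exp (1 + σ ^ (-2 : ℤ)) ≤ y) :
    1 ≤ σ ^ 2 * lambertW0 (y / (Real.exp 1 * σ ^ 2)) := by
  have hy0 : 0 < y := (Real.exp_pos _).trans_le hy
  have h : σ ^ (-2 : ℤ) ≤ lambertW0 (y / (Real.exp 1 * σ ^ 2)) := by
    refine le_lambertW0 (by positivity) (by positivity) ?_
    rw [Real.exp_add] at hy
    rw [le_div_iff₀ (by positivity)]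
    refine le_trans (le_of_eq ?_) hy
    have : σ ^ (-2 : ℤ) * σ ^ 2 = 1 := by
      rw [zpow_neg]; exact inv_mul_cancel₀ (by positivity)
    linear_combination Real.exp (σ ^ (-2 : ℤ)) * Real.exp 1 * this
  have h2 := mul_le_mul_of_nonneg_left h (sq_nonneg σ)
  refine le_trans (le_of_eq ?_) h2
  rw [zpow_neg]
  exact (mul_inv_cancel₀ (by positivity)).symm

lemma log_div_lambertW0_anti (hσ : 0 < σ) {y₁ y₂ : ℝ} (h1 : Real.exp (1 + σ ^ (-2 : ℤ)) ≤ y₁)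
    (h12 : y₁ ≤ y₂) :
    Real.log y₂ / lambertW0 (y₂ / (Real.exp 1 * σ ^ 2)) ≤
      Real.log y₁ / lambertW0 (y₁ / (Real.exp 1 * σ ^ 2)) := by
  have hy1 : 0 < y₁ := (Real.exp_pos _).trans_le h1
  have hy2 : 0 < y₂ := hy1.trans_le h12
  have hW : lambertW0 (y₁ / (Real.exp 1 * σ ^ 2)) ≤ lambertW0 (y₂ / (Real.exp 1 * σ ^ 2)) :=
    lambertW0_le_lambertW0 (by positivity) (by gcongr)
  have hu := one_le_sq_mul_lambertW0 hσ h1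
  have huv : σ ^ 2 * lambertW0 (y₁ / (Real.exp 1 * σ ^ 2)) ≤
    σ ^ 2 * lambertW0 (y₂ / (Real.exp 1 * σ ^ 2)) := by gcongr
  rw [log_div_lambertW0 hσ hy1, log_div_lambertW0 hσ hy2]
  gcongr 1 + _ * ?_
  refine Real.log_div_self_antitoneOn ?_ ?_ (by gcongr)
  · exact le_mul_of_one_le_right (Real.exp_pos _).le hu
  · exact le_mul_of_one_le_right (Real.exp_pos _).le (hu.trans huv)

lemma tendsto_log_div_id_atTop : Tendsto (fun y : ℝ => Real.log y / y) atTop (𝓝 0) := by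
  simpa using Real.isLittleO_log_id_atTop.tendsto_div_nhds_zero

lemma tendsto_log_div_lambertW0 (hσ : 0 < σ) :
    Tendsto (fun y => Real.log y / lambertW0 (y / (Real.exp 1 * σ ^ 2))) atTop (𝓝 1) := by
  have h1 : Tendsto (fun y => Real.exp 1 * (σ ^ 2 * lambertW0 (y / (Real.exp 1 * σ ^ 2))))
      atTop atTop := by
    refine Tendsto.const_mul_atTop (Real.exp_pos _) (Tendsto.const_mul_atTop (by positivity) ?_)
    exact tendsto_lambertW0_atTop.comp (tendsto_id.atTop_div_const (by positivity))
  have h2 := ((tendsto_log_div_id_atTop.comp h1).const_mul (Real.exp 1 * σ ^ 2)).const_add 1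
  simp only [mul_zero, add_zero] at h2
  refine h2.congr' ?_
  filter_upwards [eventually_gt_atTop 0] with y hy
  exact (log_div_lambertW0 hσ hy).symm

end Asymptotics

/-! ### The constant `K`: limit and monotonicity. -/

lemma genBinom_add_self (x : ℝ) (d : ℕ) :
    genBinom (x + d) d = 1 / (d.factorial : ℝ) * ∏ i ∈ Finset.Icc 1 d, (x + i) := by
  simp [genBinom]

/-- One factor `log y / y` goes to each factor of the binomial product. The quotient `y / y` stays
uncancelled so that the identity needs no hypothesis on `ε₀`. -/
lemma entropyConst_eq (d : ℕ) (σ ε₀ : ℝ) :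
    entropyConst d σ ε₀ = 1 / (d.factorial : ℝ) * ∏ i ∈ Finset.Icc 1 d,
      (2 * (yZero ε₀ / yZero ε₀) *
        (Real.log (yZero ε₀) / lambertW0 (yZero ε₀ / (Real.exp 1 * σ ^ 2))) +
          i * (Real.log (yZero ε₀) / yZero ε₀)) := by
  have h : (Real.log (yZero ε₀) / yZero ε₀) ^ d =
      ∏ i ∈ Finset.Icc 1 d, (Real.log (yZero ε₀) / yZero ε₀) := by
    rw [Finset.prod_const, Nat.card_Icc, Nat.add_sub_cancel]
  rw [entropyConst, genBinom_add_self, h, mul_assoc, ← Finset.prod_mul_distrib]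
  congr 1
  refine Finset.prod_congr rfl fun i _ => ?_
  rw [xZero]
  ring

lemma tendsto_yZero : Tendsto yZero (𝓝[>] 0) atTop :=
  Real.tendsto_log_atTop.comp (tendsto_inv_nhdsGT_zero.const_mul_atTop (by norm_num : (0 : ℝ) < 4))

lemma tendsto_entropyConst (d : ℕ) {σ : ℝ} (hσ : 0 < σ) :
    Tendsto (fun ε₀ : ℝ => entropyConst d σ ε₀) (𝓝[>] 0) (𝓝 (2 ^ d / (d.factorial : ℝ))) := by
  have hy : Tendsto (fun y : ℝ => 1 / (d.factorial : ℝ) * ∏ i ∈ Finset.Icc 1 d,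
      (2 * (y / y) * (Real.log y / lambertW0 (y / (Real.exp 1 * σ ^ 2))) +
          i * (Real.log y / y))) atTop (𝓝 (2 ^ d / (d.factorial : ℝ))) := by
    have hyy : Tendsto (fun y : ℝ => y / y) atTop (𝓝 1) := by
      refine tendsto_const_nhds.congr' ?_
      filter_upwards [eventually_ne_atTop 0] with y h
      exact (div_self h).symm
    have h := (tendsto_finsetProd (Finset.Icc 1 d) fun i _ =>
      (((hyy.const_mul 2).mul (tendsto_log_div_lambertW0 hσ)).add
        (tendsto_log_div_id_atTop.const_mul (i : ℝ)))).const_mul (1 / (d.factorial : ℝ))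
    simpa [div_eq_inv_mul] using h
  exact (hy.comp tendsto_yZero).congr fun ε => (entropyConst_eq d σ ε).symm

lemma exp_le_yZero {σ ε₀ : ℝ} (h0 : 0 < ε₀)
    (h : ε₀ ≤ 4 * Real.exp (-Real.exp (1 + σ ^ (-2 : ℤ)))) :
    Real.exp (1 + σ ^ (-2 : ℤ)) ≤ yZero ε₀ := by
  rw [yZero, Real.le_log_iff_exp_le (by positivity), le_div_iff₀ h0]
  rw [Real.exp_neg] at h
  calc _ ≤ Real.exp (Real.exp (1 + σ ^ (-2 : ℤ))) *
      (4 * (Real.exp (Real.exp (1 + σ ^ (-2 : ℤ))))⁻¹) := by gcongr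
    _ = 4 := by field_simp

lemma yZero_anti {ε ε₀ : ℝ} (h0 : 0 < ε) (h : ε ≤ ε₀) : yZero ε₀ ≤ yZero ε := by
  have : 0 < ε₀ := h0.trans_le h
  exact Real.log_le_log (by positivity) (by gcongr)

lemma entropyConst_mono {d : ℕ} {σ ε ε₀ : ℝ} (hσ : 0 < σ)
    (h : ε₀ ≤ 4 * Real.exp (-Real.exp (1 + σ ^ (-2 : ℤ)))) (h0 : 0 < ε) (hε : ε ≤ ε₀) :
    entropyConst d σ ε ≤ entropyConst d σ ε₀ := by
  have hy0 := exp_le_yZero (h0.trans_le hε) h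
  have hy := yZero_anti h0 hε
  have he : Real.exp 1 ≤ yZero ε₀ :=
    (Real.exp_le_exp.2 (le_add_of_nonneg_right (by positivity))).trans hy0
  have h1 : 1 ≤ yZero ε₀ := (Real.one_le_exp zero_le_one).trans he
  have hp0 : 0 < yZero ε₀ := by linarith
  have hp : 0 < yZero ε := by linarith
  have hW : 0 < lambertW0 (yZero ε / (Real.exp 1 * σ ^ 2)) := lambertW0_pos (by positivity)
  have hl : 0 ≤ Real.log (yZero ε) := Real.log_nonneg (by linarith)
  rw [entropyConst_eq, entropyConst_eq, div_self hp.ne', div_self hp0.ne']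
  refine mul_le_mul_of_nonneg_left (Finset.prod_le_prod (fun i _ => by positivity) fun i _ => ?_)
    (by positivity)
  refine add_le_add (mul_le_mul_of_nonneg_left (log_div_lambertW0_anti hσ hy0 hy) (by norm_num))
    (mul_le_mul_of_nonneg_left (Real.log_div_self_antitoneOn he (he.trans hy) hy) (by positivity))

/-! ### Covering unit balls of finite-dimensional spaces. -/

section Covering

open MeasureTheory Module Metric

variable {E : Type*} [NormedAddCommGroup E] [NormedSpace ℝ E] [FiniteDimensional ℝ E]

/-- Balls of radius `δ/2` about the points are disjoint and lie in the ball of radius `1 + δ/2`;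
compare Haar volumes. -/
lemma card_le_of_separated_unitBall {δ : ℝ} (hδ : 0 < δ) (s : Finset E) (hs : ∀ c ∈ s, ‖c‖ ≤ 1)
    (h : ∀ c ∈ s, ∀ d ∈ s, c ≠ d → δ ≤ ‖c - d‖) : (s.card : ℝ) ≤ (1 + 2 / δ) ^ finrank ℝ E := by
  borelize E
  let μ : Measure E := Measure.addHaar
  have hδ2 : 0 < δ / 2 := by positivity
  have hρ : 0 < 1 + δ / 2 := by positivity
  have hdisj : Set.Pairwise (s : Set E) (Function.onFun Disjoint fun c => ball (c : E) (δ / 2)) := by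
    rintro c hc d hd hcd
    apply ball_disjoint_ball
    rw [dist_eq_norm]
    linarith [h c hc d hd hcd]
  have hsub : (⋃ c ∈ s, ball (c : E) (δ / 2)) ⊆ ball (0 : E) (1 + δ / 2) := by
    refine iUnion₂_subset fun x hx => ball_subset_ball' ?_
    rw [dist_zero_right]
    linarith [hs x hx]
  have hvol : (s.card : ℝ≥0∞) * ENNReal.ofReal ((δ / 2) ^ finrank ℝ E) * μ (ball 0 1) ≤
      ENNReal.ofReal ((1 + δ / 2) ^ finrank ℝ E) * μ (ball 0 1) :=
    calc
      _ = μ (⋃ c ∈ s, ball (c : E) (δ / 2)) := by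
        rw [measure_biUnion_finset hdisj fun c _ => measurableSet_ball]
        simp only [μ.addHaar_ball_of_pos _ hδ2, Finset.sum_const, nsmul_eq_mul, mul_assoc]
      _ ≤ μ (ball (0 : E) (1 + δ / 2)) := measure_mono hsub
      _ = _ := by simp only [μ.addHaar_ball_of_pos _ hρ]
  have hle := (ENNReal.mul_le_mul_iff_left (measure_ball_pos μ _ zero_lt_one).ne'
    measure_ball_lt_top.ne).1 hvol
  have hreal := ENNReal.toReal_le_of_le_ofReal (pow_nonneg hρ.le _) hle
  rw [ENNReal.toReal_mul, ENNReal.toReal_natCast, ENNReal.toReal_ofReal (by positivity),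
    ← le_div_iff₀ (by positivity), ← div_pow] at hreal
  refine hreal.trans_eq ?_
  congr 1
  field_simp
  ring

lemma coveringNumber_unitBall_le {δ : ℝ} (hδ : 0 < δ) :
    (coveringNumber δ.toNNReal (closedBall (0 : E) 1) : ℝ≥0∞) ≤
      ENNReal.ofReal ((1 + 2 / δ) ^ finrank ℝ E) := by
  have hb : 0 ≤ (1 + 2 / δ) ^ finrank ℝ E := by positivity
  have key : ∀ s : Finset E, (s : Set E) ⊆ closedBall 0 1 → IsSeparated δ.toNNReal (s : Set E) →
      s.card ≤ ⌊(1 + 2 / δ) ^ finrank ℝ E⌋₊ := by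
    intro s hs hsep
    refine Nat.le_floor (card_le_of_separated_unitBall hδ s (fun c hc => by simpa using hs hc)
      fun c hc d hd hcd => ?_)
    have : ENNReal.ofReal δ < edist c d := hsep hc hd hcd
    rw [edist_dist, ENNReal.ofReal_lt_ofReal_iff_of_nonneg hδ.le, dist_eq_norm] at this
    exact this.le
  have hpack : packingNumber δ.toNNReal (closedBall (0 : E) 1) ≤
      (⌊(1 + 2 / δ) ^ finrank ℝ E⌋₊ : ℕ) := by
    refine iSup_le fun C => iSup_le fun hC => iSup_le fun hsep => ?_
    -- An infinite separated set would contain finite separated subsets larger than the volume bound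
    -- allows.
    have hfin : C.Finite := by
      by_contra hinf
      obtain ⟨t, htC, htcard⟩ := Set.Infinite.exists_subset_card_eq hinf
        (⌊(1 + 2 / δ) ^ finrank ℝ E⌋₊ + 1)
      have := key t (htC.trans hC) (hsep.subset htC)
      omega
    lift C to Finset E using hfin
    rw [Set.encard_coe_eq_coe_finsetCard]
    exact_mod_cast key C hC hsep
  calc (coveringNumber δ.toNNReal (closedBall (0 : E) 1) : ℝ≥0∞)
      ≤ ((⌊(1 + 2 / δ) ^ finrank ℝ E⌋₊ : ℕ) : ℕ∞) :=
        ENat.toENNReal_le.2 ((coveringNumber_le_packingNumber _ _).trans hpack)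
    _ = ENNReal.ofReal (⌊(1 + 2 / δ) ^ finrank ℝ E⌋₊ : ℝ) := by simp
    _ ≤ _ := ENNReal.ofReal_le_ofReal (Nat.floor_le hb)

/-- If the image of the unit ball lies within `r` of the unit ball of an `m`-dimensional subspace,
then it is covered by at most `(1 + 2 / δ) ^ m` balls of radius `r + δ`. -/
lemma externalCoveringNumber_le_of_approx {H F : Type*} [NormedAddCommGroup H] [NormedSpace ℝ H]
    [NormedAddCommGroup F] [NormedSpace ℝ F] (T : H →L[ℝ] F) (V : Submodule ℝ F)
    [FiniteDimensional ℝ V] {r δ : ℝ} (hr : 0 ≤ r) (hδ : 0 < δ)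
    (happ : ∀ f : H, ‖f‖ ≤ 1 → ∃ v ∈ V, ‖v‖ ≤ 1 ∧ ‖T f - v‖ ≤ r) :
    (externalCoveringNumber (r + δ).toNNReal (T '' closedBall (0 : H) 1) : ℝ≥0∞) ≤
      ENNReal.ofReal ((1 + 2 / δ) ^ finrank ℝ V) := by
  refine le_trans (ENat.toENNReal_le.2 ?_) (coveringNumber_unitBall_le (E := V) hδ)
  refine le_iInf fun C => le_iInf fun hC => le_iInf fun hcov => ?_
  refine le_trans (iInf₂_le ((↑) '' C : Set F) ?_) (encard_image_le _ _)
  rintro _ ⟨f, hf, rfl⟩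
  obtain ⟨v, hv, hv1, hfv⟩ := happ f (by simpa using hf)
  obtain ⟨c, hc, hvc⟩ := hcov (show (⟨v, hv⟩ : V) ∈ closedBall 0 1 by simpa using hv1)
  refine ⟨c, mem_image_of_mem _ hc, ?_⟩
  have hvc : edist (⟨v, hv⟩ : V) c ≤ ENNReal.ofReal δ := hvc
  rw [edist_dist, ENNReal.ofReal_le_ofReal_iff hδ.le] at hvc
  change edist (T f) (c : F) ≤ ENNReal.ofReal (r + δ)
  rw [edist_dist, ENNReal.ofReal_le_ofReal_iff (by positivity)]
  have : dist v (c : F) ≤ δ := hvc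
  exact (dist_triangle _ v _).trans (add_le_add (by rwa [dist_eq_norm]) this)

/-- A version of `externalCoveringNumber_le_of_approx` in which the approximants are linear
combinations of a family that takes at most `m` values. -/
lemma externalCoveringNumber_le_of_approx_sum {H F ι : Type*} [NormedAddCommGroup H]
    [NormedSpace ℝ H] [NormedAddCommGroup F] [NormedSpace ℝ F] (T : H →L[ℝ] F) (B : Finset F)
    {m : ℕ} (hB : B.card ≤ m) (s : Finset ι) (e : ι → F) (he : ∀ i ∈ s, e i ∈ B) {r δ : ℝ}
    (hr : 0 ≤ r) (hδ : 0 < δ)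
    (happ : ∀ f : H, ‖f‖ ≤ 1 → ∃ c : ι → ℝ, ‖∑ i ∈ s, c i • e i‖ ≤ 1 ∧
      ‖T f - ∑ i ∈ s, c i • e i‖ ≤ r) :
    (externalCoveringNumber (r + δ).toNNReal (T '' closedBall (0 : H) 1) : ℝ≥0∞) ≤
      ENNReal.ofReal ((1 + 2 / δ) ^ m) := by
  refine (externalCoveringNumber_le_of_approx T (Submodule.span ℝ (B : Set F)) hr hδ
    fun f hf => ?_).trans (ENNReal.ofReal_le_ofReal (pow_le_pow_right₀ ?_
      ((finrank_span_finset_le_card B).trans hB)))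
  · obtain ⟨c, hc1, hc2⟩ := happ f hf
    exact ⟨_, Submodule.sum_mem _ fun i hi => Submodule.smul_mem _ _
      (Submodule.subset_span (he i hi)), hc1, hc2⟩
  · exact le_add_of_nonneg_right (by positivity)

end Covering

/-! ### Feature maps and truncated kernel expansions. -/

section FeatureMap

variable {X H : Type*} [NormedAddCommGroup H] [InnerProductSpace ℝ H] [RKHS ℝ H X ℝ]
  [CompleteSpace H]

/-- Every function of a reproducing kernel Hilbert space is represented through any feature map of
the kernel by a vector of no larger norm. -/
lemma RKHS.exists_inner_featureMap {G : Type*} [NormedAddCommGroup G] [InnerProductSpace ℝ G]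
    [CompleteSpace G] (Φ : X → G) (hΦ : ∀ x y, ⟪Φ x, Φ y⟫_ℝ = RKHS.kernel H x y 1) (f : H) :
    ∃ g : G, ‖g‖ ≤ ‖f‖ ∧ ∀ x, f x = ⟪Φ x, g⟫_ℝ := by
  let A : (X →₀ ℝ) →ₗ[ℝ] H := Finsupp.linearCombination ℝ fun x => RKHS.kerFun H x 1
  let B : (X →₀ ℝ) →ₗ[ℝ] G := Finsupp.linearCombination ℝ Φ
  have hin : ∀ u v, ⟪A u, A v⟫_ℝ = ⟪B u, B v⟫_ℝ := by
    intro u v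
    simp only [A, B, Finsupp.linearCombination_apply, Finsupp.sum_inner, Finsupp.inner_sum]
    refine Finsupp.sum_congr fun x _ => Finsupp.sum_congr fun y _ => ?_
    have h1 : ∀ x y, ⟪RKHS.kerFun H x (1 : ℝ), RKHS.kerFun H y 1⟫_ℝ = RKHS.kernel H x y 1 :=
      fun x y => by rw [RKHS.kerFun_inner, RKHS.kerFun_apply]; simp
    simp only [real_inner_smul_left, real_inner_smul_right, h1, hΦ]
  have hdense : DenseRange A := by
    have h := RKHS.kerFun_dense H
    have hle : Submodule.span ℝ {RKHS.kerFun H x v | (x : X) (v : ℝ)} ≤ LinearMap.range A := by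
      refine Submodule.span_le.2 ?_
      rintro _ ⟨x, v, rfl⟩
      refine ⟨Finsupp.single x v, ?_⟩
      simp [A, ← map_smul]
    have h2 := Submodule.topologicalClosure_mono hle
    rw [h, top_le_iff] at h2
    have h3 : Dense ((LinearMap.range A : Submodule ℝ H) : Set H) :=
      Submodule.dense_iff_topologicalClosure_eq_top.2 h2
    simpa [DenseRange, LinearMap.coe_range] using h3
  -- Equal Gram matrices make `k(·, x) ↦ Φ x` isometric on the dense span of kernel functions; `J`
  -- is its extension to `H`, and `J f` is the required vector.
  have hnorm : ∀ u, ‖B u‖ = ‖A u‖ := fun u => by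
    rw [norm_eq_sqrt_real_inner, norm_eq_sqrt_real_inner, hin]
  let J : H →L[ℝ] G := B.extendOfNorm A
  have hJ : ∀ u, J (A u) = B u :=
    LinearMap.extendOfNorm_eq hdense ⟨1, fun u => by rw [one_mul, hnorm]⟩
  have hJn : ∀ f, ‖J f‖ ≤ ‖f‖ := fun f => by
    simpa using LinearMap.norm_extendOfNorm_apply_le hdense 1
      (fun u => by rw [one_mul, hnorm]) f
  refine ⟨J f, hJn f, fun x => ?_⟩
  have hΦx : Φ x = B (Finsupp.single x 1) := by simp [B]
  have hkx : RKHS.kerFun H x 1 = A (Finsupp.single x 1) := by simp [A]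
  have hfx : f x = ⟪RKHS.kerFun H x (1 : ℝ), f⟫_ℝ := by simp
  rw [hfx, hkx, hΦx]
  refine congrFun (hdense.equalizer (by fun_prop) (by fun_prop) (funext fun u => ?_) :
    (fun h => ⟪A (Finsupp.single x 1), h⟫_ℝ) = fun h => ⟪B (Finsupp.single x 1), J h⟫_ℝ) f
  simp only [Function.comp_apply]
  rw [hJ, hin]

/-- Truncation of a feature expansion `k(x, y) = ∑ i, e i x * e i y` of the kernel. -/
lemma RKHS.exists_truncation {ι : Type*} (e : ι → X → ℝ)
    (he : ∀ x y, HasSum (fun i => e i x * e i y) (RKHS.kernel H x y 1)) (f : H) :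
    ∃ c : ι → ℝ, ∀ (s : Finset ι) (x : X),
      |∑ i ∈ s, c i * e i x| ≤ √(∑ i ∈ s, e i x ^ 2) * ‖f‖ ∧
      |f x - ∑ i ∈ s, c i * e i x| ≤ √(RKHS.kernel H x x 1 - ∑ i ∈ s, e i x ^ 2) * ‖f‖ := by
  classical
  let Φ : X → lp (fun _ : ι => ℝ) 2 := fun x => ⟨fun i => e i x, by
    refine memℓp_gen ?_
    have := (he x x).summable
    simpa [← sq] using this⟩
  have hΦ : ∀ x y, ⟪Φ x, Φ y⟫_ℝ = RKHS.kernel H x y 1 := fun x y => by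
    refine (lp.hasSum_inner (Φ x) (Φ y)).unique ?_
    refine (he x y).congr_fun fun i => ?_
    simp [Φ, mul_comm]
  obtain ⟨g, hg, hfg⟩ := RKHS.exists_inner_featureMap Φ hΦ f
  have hcs : ∀ (t : Finset ι) (x : X), |∑ i ∈ t, g i * e i x| ≤ √(∑ i ∈ t, e i x ^ 2) * ‖f‖ := by
    intro t x
    have h1 : ∑ i ∈ t, g i ^ 2 ≤ ‖f‖ ^ 2 := by
      have := lp.sum_rpow_le_norm_rpow (p := 2) (by simp) g t
      simp only [ENNReal.toReal_ofNat, Real.rpow_ofNat, Real.norm_eq_abs, sq_abs] at this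
      exact this.trans (by gcongr)
    have h2 := Finset.sum_mul_sq_le_sq_mul_sq t (fun i => g i) (fun i => e i x)
    have h3 : 0 ≤ ∑ i ∈ t, e i x ^ 2 := Finset.sum_nonneg fun i _ => sq_nonneg _
    refine abs_le_of_sq_le_sq ?_ (by positivity)
    rw [mul_pow, Real.sq_sqrt h3, mul_comm]
    exact h2.trans (by gcongr)
  refine ⟨g, fun s x => ⟨hcs s x, ?_⟩⟩
  have hs : HasSum (fun i => g i * e i x) (f x) := by
    rw [hfg x]
    exact (lp.hasSum_inner (Φ x) g).congr_fun fun i => by simp [Φ]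
  -- The tail is a limit of finite sums over `t \ s`; each is bounded by Cauchy–Schwarz, and the
  -- squares over `t` sum to at most `k(x, x)`.
  have hlim := ((hs.sub_const (∑ i ∈ s, g i * e i x)).abs)
  refine le_of_tendsto hlim ?_
  filter_upwards [eventually_ge_atTop s] with t hst
  rw [← Finset.sum_sdiff hst, add_sub_cancel_right]
  refine (hcs _ x).trans ?_
  gcongr
  rw [le_sub_iff_add_le, Finset.sum_sdiff hst]
  have := (he x x)
  simp only [← sq] at this
  exact sum_le_hasSum t (fun i _ => sq_nonneg _) this

end FeatureMap

/-! ### The expansion of the Gaussian kernel over words. -/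

noncomputable section

/-- The element of the standard orthonormal expansion of the Gaussian kernel that belongs to the
monomial with the multiset `m` of variables, scaled so that summation over all words in the
variables reproduces the kernel. -/
def gaussianMonomial {d : ℕ} (σ : ℝ) (m : Multiset (Fin d)) (x : EuclideanSpace ℝ (Fin d)) : ℝ :=
  Real.exp (-σ ^ 2 * ‖x‖ ^ 2) * √((2 * σ ^ 2) ^ m.card / (m.card.factorial : ℝ)) *
    (m.map fun i => x i).prod

/-- The multiset of letters of a word. -/
def wordMultiset {d : ℕ} (w : Σ n : ℕ, Fin n → Fin d) : Multiset (Fin d) :=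
  Finset.univ.val.map w.2

variable {d : ℕ} {σ : ℝ}

lemma card_wordMultiset (w : Σ n : ℕ, Fin n → Fin d) : (wordMultiset w).card = w.1 := by
  simp [wordMultiset]

lemma gaussianMonomial_word (w : Σ n : ℕ, Fin n → Fin d) (x : EuclideanSpace ℝ (Fin d)) :
    gaussianMonomial σ (wordMultiset w) x =
      Real.exp (-σ ^ 2 * ‖x‖ ^ 2) * √((2 * σ ^ 2) ^ w.1 / (w.1.factorial : ℝ)) *
        ∏ j, x (w.2 j) := by
  rw [gaussianMonomial, card_wordMultiset, wordMultiset, Multiset.map_map]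
  rfl

lemma gaussianMonomial_mul (w : Σ n : ℕ, Fin n → Fin d) (x y : EuclideanSpace ℝ (Fin d)) :
    gaussianMonomial σ (wordMultiset w) x * gaussianMonomial σ (wordMultiset w) y =
      Real.exp (-σ ^ 2 * ‖x‖ ^ 2) * Real.exp (-σ ^ 2 * ‖y‖ ^ 2) *
        ((2 * σ ^ 2) ^ w.1 / (w.1.factorial : ℝ) * ∏ j, x (w.2 j) * y (w.2 j)) := by
  have h : √((2 * σ ^ 2) ^ w.1 / (w.1.factorial : ℝ)) *
      √((2 * σ ^ 2) ^ w.1 / (w.1.factorial : ℝ)) = (2 * σ ^ 2) ^ w.1 / (w.1.factorial : ℝ) :=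
    Real.mul_self_sqrt (by positivity)
  rw [gaussianMonomial_word, gaussianMonomial_word, Finset.prod_mul_distrib]
  linear_combination Real.exp (-σ ^ 2 * ‖x‖ ^ 2) * Real.exp (-σ ^ 2 * ‖y‖ ^ 2) *
    (∏ j, x (w.2 j)) * (∏ j, y (w.2 j)) * h

/-- Summing over words rather than exponents expands `(∑ a_i)^n` without multinomial coefficients.
-/
lemma sum_word_prod (n : ℕ) (C : ℝ) (a : Fin d → ℝ) :
    ∑ w : Fin n → Fin d, C * ((2 * σ ^ 2) ^ n / (n.factorial : ℝ) * ∏ j, a (w j)) =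
      C * ((2 * σ ^ 2 * ∑ i, a i) ^ n / (n.factorial : ℝ)) := by
  rw [← Finset.mul_sum, ← Finset.mul_sum, ← Fintype.sum_pow, mul_pow]
  ring

lemma hasSum_exp (t : ℝ) : HasSum (fun n : ℕ => t ^ n / (n.factorial : ℝ)) (Real.exp t) := by
  rw [Real.exp_eq_exp_ℝ]
  exact NormedSpace.expSeries_div_hasSum_exp t

lemma hasSum_word (C : ℝ) (a : Fin d → ℝ) :
    HasSum (fun w : Σ n : ℕ, Fin n → Fin d =>
      C * ((2 * σ ^ 2) ^ w.1 / (w.1.factorial : ℝ) * ∏ j, a (w.2 j)))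
      (C * Real.exp (2 * σ ^ 2 * ∑ i, a i)) := by
  refine HasSum.sigma_of_hasSum ((hasSum_exp (2 * σ ^ 2 * ∑ i, a i)).mul_left C)
    (fun n => ?_) ?_
  · rw [← sum_word_prod]
    exact hasSum_fintype _
  -- Taking absolute values replaces `a` by `|a|` and `C` by `|C|`, again giving an exponential
  -- series.
  · rw [← summable_abs_iff, summable_sigma_of_nonneg fun _ => abs_nonneg _]
    refine ⟨fun n => (hasSum_fintype _).summable, ?_⟩
    refine ((hasSum_exp (2 * σ ^ 2 * ∑ i, |a i|)).mul_left |C|).summable.congr fun n => ?_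
    rw [tsum_fintype, ← sum_word_prod]
    refine Finset.sum_congr rfl fun w _ => ?_
    rw [abs_mul, abs_mul, Finset.abs_prod, abs_of_nonneg (a := _ / _) (by positivity)]

lemma hasSum_gaussianMonomial (x y : EuclideanSpace ℝ (Fin d)) :
    HasSum (fun w : Σ n : ℕ, Fin n → Fin d =>
      gaussianMonomial σ (wordMultiset w) x * gaussianMonomial σ (wordMultiset w) y)
      (Real.exp (-σ ^ 2 * ‖x - y‖ ^ 2)) := by
  have h := hasSum_word (σ := σ) (Real.exp (-σ ^ 2 * ‖x‖ ^ 2) * Real.exp (-σ ^ 2 * ‖y‖ ^ 2))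
    fun i => x i * y i
  simp only [← gaussianMonomial_mul] at h
  convert h using 1
  rw [← Real.exp_add, ← Real.exp_add, norm_sub_sq_real]
  congr 1
  have : ⟪x, y⟫_ℝ = ∑ i, x i * y i := by simp [PiLp.inner_apply, mul_comm]
  rw [this]
  ring

/-- The words of length less than `N`. -/
def wordsBelow (d N : ℕ) : Finset (Σ n : ℕ, Fin n → Fin d) :=
  (Finset.range N).sigma fun _ => Finset.univ

lemma sum_sq_gaussianMonomial (N : ℕ) (x : EuclideanSpace ℝ (Fin d)) :
    ∑ w ∈ wordsBelow d N, gaussianMonomial σ (wordMultiset w) x ^ 2 =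
      Real.exp (-(2 * σ ^ 2 * ‖x‖ ^ 2)) *
        ∑ n ∈ Finset.range N, (2 * σ ^ 2 * ‖x‖ ^ 2) ^ n / (n.factorial : ℝ) := by
  rw [wordsBelow, Finset.sum_sigma, Finset.mul_sum]
  refine Finset.sum_congr rfl fun n _ => ?_
  simp only [sq (gaussianMonomial _ _ _), gaussianMonomial_mul]
  rw [sum_word_prod n _ fun i => x i * x i, ← Real.exp_add, EuclideanSpace.norm_sq_eq]
  simp only [Real.norm_eq_abs, sq_abs, ← sq]
  congr 2
  ring

/-- Since `N! k!` divides `(N + k)!`, each tail term is at most `(t^N / N!) (t^k / k!)`. The factor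
`exp t` is later cancelled by the Gaussian weight. -/
lemma exp_sub_sum_range_le {t : ℝ} (ht : 0 ≤ t) (N : ℕ) :
    Real.exp t - ∑ n ∈ Finset.range N, t ^ n / (n.factorial : ℝ) ≤
      t ^ N / (N.factorial : ℝ) * Real.exp t := by
  have h1 := (hasSum_nat_add_iff' N).2 (hasSum_exp t)
  have h2 := (hasSum_exp t).mul_left (t ^ N / (N.factorial : ℝ))
  refine hasSum_le (fun k => ?_) h1 h2
  rw [div_mul_div_comm, ← pow_add, add_comm N k]
  gcongr
  exact_mod_cast (mul_comm _ _).trans_le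
    (Nat.le_of_dvd (Nat.factorial_pos _) (Nat.factorial_mul_factorial_dvd_factorial_add k N))

lemma one_sub_sum_sq_gaussianMonomial_le (N : ℕ) {x : EuclideanSpace ℝ (Fin d)} (hx : ‖x‖ ≤ 1) :
    1 - ∑ w ∈ wordsBelow d N, gaussianMonomial σ (wordMultiset w) x ^ 2 ≤
      (2 * σ ^ 2) ^ N / (N.factorial : ℝ) := by
  have ht : 0 ≤ 2 * σ ^ 2 * ‖x‖ ^ 2 := by positivity
  have h := mul_le_mul_of_nonneg_left (exp_sub_sum_range_le ht N)
    (Real.exp_pos (-(2 * σ ^ 2 * ‖x‖ ^ 2))).le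
  have he : Real.exp (-(2 * σ ^ 2 * ‖x‖ ^ 2)) * Real.exp (2 * σ ^ 2 * ‖x‖ ^ 2) = 1 := by
    rw [← Real.exp_add]; simp
  rw [mul_sub, he, mul_left_comm, he, mul_one] at h
  rw [sum_sq_gaussianMonomial]
  refine h.trans ?_
  gcongr ?_ ^ _ / _
  exact mul_le_of_le_one_right (by positivity) (pow_le_one₀ (norm_nonneg _) hx)

lemma memℓp_gaussianMonomial (m : Multiset (Fin d)) :
    Memℓp (fun x : Metric.closedBall (0 : EuclideanSpace ℝ (Fin d)) 1 => gaussianMonomial σ m x)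
      ∞ := by
  have hc : Continuous (gaussianMonomial σ m) := by
    unfold gaussianMonomial
    have : Continuous fun x : EuclideanSpace ℝ (Fin d) => (m.map fun i => x i).prod :=
      continuous_multiset_prod m fun i _ => by fun_prop
    fun_prop
  obtain ⟨C, hC⟩ := (isCompact_closedBall
    (0 : EuclideanSpace ℝ (Fin d)) 1).exists_bound_of_continuousOn hc.continuousOn
  exact memℓp_infty ⟨C, by rintro _ ⟨x, rfl⟩; exact hC x x.2⟩

/-- The functions `gaussianMonomial` as bounded functions on the unit ball. -/
def boundedGaussianMonomial (σ : ℝ) (m : Multiset (Fin d)) :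
    lp (fun _ : Metric.closedBall (0 : EuclideanSpace ℝ (Fin d)) 1 => ℝ) ∞ :=
  ⟨_, memℓp_gaussianMonomial (σ := σ) m⟩

open Classical in
-- Words with equal letters up to order give the same function, so multisets of size at most `M` are
-- counted instead of words.
lemma card_image_wordMultiset_le (M : ℕ) :
    ((wordsBelow d (M + 1)).image wordMultiset).card ≤ (M + d).choose d := by
  have hsub : (wordsBelow d (M + 1)).image wordMultiset ⊆
      (Finset.range (M + 1)).biUnion fun n =>
        Finset.univ.image fun s : Sym (Fin d) n => (s : Multiset (Fin d)) := by
    intro m hm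
    obtain ⟨w, hw, rfl⟩ := Finset.mem_image.1 hm
    refine Finset.mem_biUnion.2 ⟨w.1, (Finset.mem_sigma.1 hw).1, Finset.mem_image.2
      ⟨(⟨wordMultiset w, card_wordMultiset w⟩ : Sym (Fin d) w.1), Finset.mem_univ _, rfl⟩⟩
  calc _ ≤ _ := Finset.card_le_card hsub
    _ ≤ ∑ n ∈ Finset.range (M + 1), d.multichoose n := by
      refine Finset.card_biUnion_le.trans (Finset.sum_le_sum fun n _ => ?_)
      refine Finset.card_image_le.trans_eq ?_
      rw [Finset.card_univ, Sym.card_sym_eq_multichoose, Fintype.card_fin]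
    _ = _ := Nat.sum_range_multichoose M d

lemma exists_approx_gaussianEmbedding (N : ℕ)
    (f : GaussianRKHS σ (Metric.closedBall (0 : EuclideanSpace ℝ (Fin d)) 1)) (hf : ‖f‖ ≤ 1) :
    ∃ c : (Σ n : ℕ, Fin n → Fin d) → ℝ,
      ‖∑ w ∈ wordsBelow d N, c w • boundedGaussianMonomial σ (wordMultiset w)‖ ≤ 1 ∧
      ‖gaussianEmbedding σ _ f -
        ∑ w ∈ wordsBelow d N, c w • boundedGaussianMonomial σ (wordMultiset w)‖ ≤
          √((2 * σ ^ 2) ^ N / (N.factorial : ℝ)) := by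
  obtain ⟨c, hc⟩ := RKHS.exists_truncation
    (fun (w : Σ n : ℕ, Fin n → Fin d) (x : Metric.closedBall (0 : EuclideanSpace ℝ (Fin d)) 1) =>
      gaussianMonomial σ (wordMultiset w) (x : EuclideanSpace ℝ (Fin d)))
    (fun x y => by
      rw [RKHS.OfKernel.kernel_ofKernel, gaussianKernel_apply, mul_one]
      exact hasSum_gaussianMonomial _ _) f
  set v := ∑ w ∈ wordsBelow d N, c w • boundedGaussianMonomial σ (wordMultiset w)
  have hv : ∀ x : Metric.closedBall (0 : EuclideanSpace ℝ (Fin d)) 1,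
      v x = ∑ w ∈ wordsBelow d N, c w * gaussianMonomial σ (wordMultiset w) x := by
    intro x
    simp only [v, lp.coeFn_sum]
    exact Finset.sum_apply _ _ _
  have hk : ∀ x : Metric.closedBall (0 : EuclideanSpace ℝ (Fin d)) 1,
      RKHS.kernel (GaussianRKHS σ (Metric.closedBall (0 : EuclideanSpace ℝ (Fin d)) 1)) x x 1
        = 1 := by
    intro x
    rw [RKHS.OfKernel.kernel_ofKernel, gaussianKernel_apply]
    simp
  refine ⟨c,
    lp.norm_le_of_forall_le zero_le_one fun x => ?_,
    lp.norm_le_of_forall_le (Real.sqrt_nonneg _) fun x => ?_⟩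
  · rw [hv, Real.norm_eq_abs]
    -- Partial sums of `e_w(x)²` do not exceed `k(x, x) = 1`.
    refine (hc _ x).1.trans (mul_le_one₀ (Real.sqrt_le_one.2 ?_) (norm_nonneg _) hf)
    have h := hasSum_gaussianMonomial (σ := σ) (x : EuclideanSpace ℝ (Fin d)) x
    simp only [← sq] at h
    simpa using sum_le_hasSum (wordsBelow d N) (fun i _ => sq_nonneg _) h
  · have h := (hc (wordsBelow d N) x).2
    rw [hk, ← hv] at h
    refine h.trans ((mul_le_of_le_one_right (Real.sqrt_nonneg _) hf).trans ?_)
    exact Real.sqrt_le_sqrt (one_sub_sum_sq_gaussianMonomial_le _ (mem_closedBall_zero_iff.1 x.2))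

/-! ### Choice of the truncation length and the final bound. -/

lemma cast_choose_le_genBinom {M : ℕ} {x : ℝ} (h : (M : ℝ) ≤ x) :
    ((M + d).choose d : ℝ) ≤ genBinom (x + d) d := by
  rw [genBinom_add_self]
  rw [← Finset.Ico_add_one_right_eq_Icc, Finset.prod_Ico_eq_prod_range, Nat.add_sub_cancel,
    one_div, ← div_eq_inv_mul, le_div_iff₀ (by positivity)]
  have hasc := Nat.ascFactorial_eq_factorial_mul_choose M d
  rw [Nat.ascFactorial_eq_prod_range] at hasc
  calc ((M + d).choose d : ℝ) * d.factorial
      = ((∏ i ∈ Finset.range d, (M + 1 + i) : ℕ) : ℝ) := by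
        rw [hasc]; push_cast; ring
    _ = ∏ i ∈ Finset.range d, ((M : ℝ) + (1 + i : ℕ)) := by
        push_cast
        exact Finset.prod_congr rfl fun i _ => by ring
    _ ≤ _ := Finset.prod_le_prod (fun i _ => by positivity) fun i _ => by gcongr

/-- Here `x₀ = 2 e σ² exp W`, and `N! ≥ (N/e)^N` gives `(2σ²)^N / N! ≤ (2 e σ² / N)^N ≤ exp(-W N) ≤
exp(-W x₀)`. As `W x₀ = 2 y₀`, the last term is `(ε/4)²`. -/
lemma pow_div_factorial_le (hσ : 0 < σ) {ε : ℝ} (hε : 0 < ε) (hy : 0 < yZero ε) {N : ℕ}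
    (hN : xZero σ ε ≤ N) :
    √((2 * σ ^ 2) ^ N / (N.factorial : ℝ)) ≤ ε / 4 := by
  set W := lambertW0 (yZero ε / (Real.exp 1 * σ ^ 2)) with hWdef
  have hW : 0 < W := lambertW0_pos (by positivity)
  have hyW : yZero ε = Real.exp 1 * σ ^ 2 * (W * Real.exp W) := eq_lambertW0_mul_exp hσ hy
  have hx : xZero σ ε = 2 * (Real.exp 1 * σ ^ 2) * Real.exp W := by
    rw [xZero, ← hWdef, div_eq_iff hW.ne', hyW]
    ring
  have hN0 : (0 : ℝ) < N := lt_of_lt_of_le (by rw [hx]; positivity) hN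
  rw [Real.sqrt_le_left (by positivity)]
  have h1 : (N : ℝ) ^ N / (N.factorial : ℝ) ≤ Real.exp 1 ^ N := by
    rw [← Real.exp_nat_mul, mul_one]
    exact Real.pow_div_factorial_le_exp _ hN0.le N
  have h2 : 2 * σ ^ 2 * Real.exp 1 / N ≤ Real.exp (-W) := by
    rw [div_le_iff₀ hN0, Real.exp_neg, ← div_eq_inv_mul, le_div_iff₀ (Real.exp_pos _)]
    rw [hx] at hN
    linarith
  have h3 : Real.exp (-W) ^ N ≤ Real.exp (-(2 * yZero ε)) := by
    rw [← Real.exp_nat_mul, Real.exp_le_exp]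
    have : 2 * yZero ε = xZero σ ε * W := by
      rw [xZero, ← hWdef, div_mul_cancel₀ _ hW.ne']
    rw [this]
    nlinarith
  have h4 : Real.exp (-(2 * yZero ε)) = (ε / 4) ^ 2 := by
    rw [← mul_neg, yZero, ← Real.log_inv, inv_div, mul_comm, Real.exp_mul,
      Real.exp_log (by positivity)]
    norm_num
  calc (2 * σ ^ 2) ^ N / (N.factorial : ℝ)
      = (2 * σ ^ 2 / N) ^ N * ((N : ℝ) ^ N / (N.factorial : ℝ)) := by
        rw [div_pow]; field_simp
    _ ≤ (2 * σ ^ 2 / N) ^ N * Real.exp 1 ^ N := by gcongr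
    _ = (2 * σ ^ 2 * Real.exp 1 / N) ^ N := by rw [← mul_pow]; ring
    _ ≤ Real.exp (-W) ^ N := by gcongr
    _ ≤ _ := h3
    _ = _ := h4

open Classical in
lemma logCoveringNumber_le (hσ : 0 < σ) {ε : ℝ} (hε : 0 < ε) (hy : 1 < yZero ε)
    (hε1 : ε ≤ 4 / 3) :
    logCoveringNumber ε
        (gaussianEmbedding σ (Metric.closedBall (0 : EuclideanSpace ℝ (Fin d)) 1)) ≤
      ((genBinom (xZero σ ε + d) d * yZero ε : ℝ) : EReal) := by
  have hy0 : 0 < yZero ε := by linarith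
  have hW : 0 < lambertW0 (yZero ε / (Real.exp 1 * σ ^ 2)) := lambertW0_pos (by positivity)
  have hx : 0 < xZero σ ε := by rw [xZero]; positivity
  -- Then `M ≤ x₀ ≤ M + 1`: the upper bound controls the truncation error, the lower one the
  -- dimension.
  obtain ⟨M, hM⟩ : ∃ M, ⌈xZero σ ε⌉₊ = M + 1 :=
    Nat.exists_eq_succ_of_ne_zero (Nat.ceil_pos.2 hx).ne'
  have hMx : (M : ℝ) ≤ xZero σ ε := (Nat.lt_ceil.1 (by omega)).le
  have hxM : xZero σ ε ≤ (M + 1 : ℕ) := hM ▸ Nat.le_ceil _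
  have hcov := externalCoveringNumber_le_of_approx_sum
    (gaussianEmbedding σ (Metric.closedBall (0 : EuclideanSpace ℝ (Fin d)) 1))
    (((wordsBelow d (M + 1)).image wordMultiset).image (boundedGaussianMonomial σ))
    (Finset.card_image_le.trans (card_image_wordMultiset_le M)) (wordsBelow d (M + 1))
    (fun w => boundedGaussianMonomial σ (wordMultiset w))
    (fun w hw => Finset.mem_image_of_mem _ (Finset.mem_image_of_mem _ hw))
    (r := ε / 4) (δ := 3 * ε / 4) (by positivity) (by positivity) fun f hf => by
      obtain ⟨c, hc1, hc2⟩ := exists_approx_gaussianEmbedding (M + 1) f hf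
      exact ⟨c, hc1, hc2.trans (pow_div_factorial_le hσ hε hy0 hxM)⟩
  rw [show ε / 4 + 3 * ε / 4 = ε by ring] at hcov
  -- Splitting `ε = ε/4 + 3ε/4` gives the base `1 + 8/(3ε)`, which is at most `4/ε` exactly when `ε
  -- ≤ 4/3`.
  have hbase : 1 + 2 / (3 * ε / 4) ≤ 4 / ε := by
    rw [show 2 / (3 * ε / 4) = (8 / 3) / ε by field_simp; norm_num, le_div_iff₀ hε, add_mul,
      div_mul_cancel₀ _ hε.ne']
    linarith
  have hpow : (1 + 2 / (3 * ε / 4)) ^ (M + d).choose d ≤ (4 / ε) ^ (M + d).choose d :=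
    pow_le_pow_left₀ (by positivity) hbase _
  calc _ ≤ ENNReal.log (ENNReal.ofReal ((4 / ε) ^ (M + d).choose d)) :=
        ENNReal.log_monotone (hcov.trans (ENNReal.ofReal_le_ofReal hpow))
    _ = (((M + d).choose d * yZero ε : ℝ) : EReal) := by
        rw [ENNReal.log_ofReal_of_pos (by positivity), Real.log_pow, yZero]
    _ ≤ _ := by
        refine EReal.coe_le_coe_iff.2 (mul_le_mul_of_nonneg_right ?_ hy0.le)
        exact cast_choose_le_genBinom hMx

end

theorem theorem2 (d : ℕ) (hd : 1 ≤ d) (σ : ℝ) (hσ : 0 < σ) :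
    (∀ ε₀ : ℝ, 0 < ε₀ → ε₀ ≤ 4 * Real.exp (-Real.exp (1 + σ ^ (-2 : ℤ))) →
      ∀ ε : ℝ, 0 < ε → ε ≤ ε₀ →
        logCoveringNumber ε
            (gaussianEmbedding σ (Metric.closedBall (0 : EuclideanSpace ℝ (Fin d)) 1)) ≤
          ((entropyConst d σ ε₀ *
            (Real.log (4 / ε) ^ (d + 1) / Real.log (Real.log (4 / ε)) ^ d) : ℝ) : EReal)) ∧
    Tendsto (fun ε₀ : ℝ => entropyConst d σ ε₀) (𝓝[>] 0) (𝓝 (2 ^ d / (d.factorial : ℝ))) := by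
  refine ⟨fun ε₀ h0 hε₀ ε hε hle => ?_, tendsto_entropyConst d hσ⟩
  have hy := (exp_le_yZero h0 hε₀).trans (yZero_anti hε hle)
  have he : Real.exp 1 < yZero ε :=
    (Real.exp_lt_exp.2 (lt_add_of_pos_right _ (by positivity))).trans_le hy
  have he2 := Real.exp_one_gt_d9
  have hy2 : 2 < yZero ε := by linarith
  have hεs : ε ≤ 4 / 3 := by
    have : Real.exp 2 < 4 / ε := (Real.lt_log_iff_exp_lt (by positivity)).1 hy2
    have h3 : (3 : ℝ) ≤ Real.exp 2 := by linarith [Real.add_one_le_exp 2]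
    have h4 := h3.trans this.le
    rw [le_div_iff₀ hε] at h4
    linarith
  have hlog : 0 < Real.log (yZero ε) := Real.log_pos (by linarith)
  refine (logCoveringNumber_le hσ hε (by linarith) hεs).trans (EReal.coe_le_coe_iff.2 ?_)
  calc genBinom (xZero σ ε + d) d * yZero ε
      = entropyConst d σ ε * (yZero ε ^ (d + 1) / Real.log (yZero ε) ^ d) := by
        rw [entropyConst, div_pow]
        field_simp
        ring
    _ ≤ entropyConst d σ ε₀ * (yZero ε ^ (d + 1) / Real.log (yZero ε) ^ d) :=
        mul_le_mul_of_nonneg_right (entropyConst_mono hσ hε₀ hε hle) (by positivity)
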